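/- Let $X$ be a Polish space, let $C \subseteq X$ be a comeager Borel set, and let $G$ be a Borel graph on $C$, i.e. a symmetric irreflexive relation on $C$ that is Borel as a subset of $C \times C$. Suppose that $G$ is acyclic and $4$-regular (every vertex has exactly four neighbors). Then there are a Borel set $A \subseteq C$ that is comeager in $X$ and $G$-invariant (a union of connected components of $G$), and a free action of the free group $\mathbb{F}_2 = \langle a, b \rangle$ on $A$ by Borel automorphisms which generates the induced graph $G \restriction A$: for all $x, y \in A$, $x$ and $y$ are adjacent in $G$ if and only if $x \neq y$ and $y = s \cdot x$ for some $s \in \{a, a^{-1}, b, b^{-1}\}$. -/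

import Mathlib

/-- A graph on a measurable space (with its Borel `σ`-algebra) is a Borel graph if its edge
relation is Borel as a subset of the square of the vertex space. -/
def SimpleGraph.IsBorelGraph {V : Type*} [MeasurableSpace V] (G : SimpleGraph V) : Prop :=
  MeasurableSet {p : V × V | G.Adj p.1 p.2}

/-- A set of vertices is `G`-invariant if it is a union of connected components of `G`. -/
def SimpleGraph.IsInvariantSet {V : Type*} (G : SimpleGraph V) (A : Set V) : Prop :=
  ∃ S : Set G.ConnectedComponent, A = ⋃ c ∈ S, c.supp

/-- An action of a (countable discrete) group is Borel if every group element acts by a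
Borel map; its inverse then acts by a Borel map too, so the group acts by Borel
automorphisms. -/
def IsBorelAction (Γ Y : Type*) [Group Γ] [MulAction Γ Y] [MeasurableSpace Y] : Prop :=
  ∀ γ : Γ, Measurable fun y : Y => γ • y

/-- An action is free if no non-identity group element fixes a point. -/
def IsFreeAction (Γ Y : Type*) [Group Γ] [MulAction Γ Y] : Prop :=
  ∀ (γ : Γ) (y : Y), γ • y = y → γ = 1

/-- An action of the free group on `ι` generates the graph `H` if the edges of `H` are exactly
the pairs of distinct points `x`, `y` such that `y` is the image of `x` under one of the free
generators or the inverse of one. -/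
def ActionGenerates (ι : Type*) {Y : Type*} [MulAction (FreeGroup ι) Y] (H : SimpleGraph Y) : Prop :=
  ∀ x y : Y, H.Adj x y ↔
    x ≠ y ∧ ∃ i : ι, FreeGroup.of i • x = y ∨ (FreeGroup.of i)⁻¹ • x = y

/-! ### Measurable enumeration of the neighbors in a regular Borel graph -/

namespace SimpleGraph

variable {V : Type*} [MeasurableSpace V] [StandardBorelSpace V]

open Classical in
-- Suslin's theorem: the set is analytic as a projection of k-tuples of distinct neighbors, and so
-- is its complement, since fewer than k neighbors in B means at least n + 1 - k outside B.
theorem measurableSet_le_card_neighborFinset_filter (G : SimpleGraph V) [G.LocallyFinite]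
    (hG : G.IsBorelGraph) {n : ℕ} (hn : G.IsRegularOfDegree n) {B : Set V} (hB : MeasurableSet B)
    (k : ℕ) : MeasurableSet {x | k ≤ ((G.neighborFinset x).filter (· ∈ B)).card} := by
  let := upgradeStandardBorel V
  have key : ∀ (B : Set V), MeasurableSet B → ∀ k : ℕ,
      MeasureTheory.AnalyticSet {x | k ≤ ((G.neighborFinset x).filter (· ∈ B)).card} := by
    intro B hB k
    have himage : {x | k ≤ ((G.neighborFinset x).filter (· ∈ B)).card} = Prod.fst ''
        {p : V × (Fin k → V) | (∀ i j, i ≠ j → p.2 i ≠ p.2 j) ∧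
          ∀ j, G.Adj p.1 (p.2 j) ∧ p.2 j ∈ B} := by
      ext x
      constructor
      · intro hx
        obtain ⟨t, ht, htk⟩ := Finset.exists_subset_card_eq hx
        refine ⟨(x, fun j => (t.equivFinOfCardEq htk).symm j), ⟨?_, ?_⟩, rfl⟩
        · intro i j hij h
          exact hij ((t.equivFinOfCardEq htk).symm.injective (Subtype.ext h))
        · intro j
          have := ht ((t.equivFinOfCardEq htk).symm j).2
          simpa using this
      · rintro ⟨⟨x', y⟩, ⟨hinj, hy⟩, rfl⟩
        have hy_inj : Function.Injective y := fun i j h => by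
          by_contra hij
          exact hinj i j hij h
        calc k = (Finset.univ.image y).card := by
              rw [Finset.card_image_of_injective _ hy_inj, Finset.card_univ, Fintype.card_fin]
          _ ≤ _ := by
              apply Finset.card_le_card
              intro z hz
              obtain ⟨j, -, rfl⟩ := Finset.mem_image.1 hz
              simpa using hy j
    rw [himage]
    refine MeasurableSet.analyticSet_image ?_ measurable_fst
    have hmeas : ∀ j : Fin k, Measurable fun p : V × (Fin k → V) => p.2 j := fun j =>
      (measurable_pi_apply j).comp measurable_snd
    simp only [Set.ofPred_and, Set.ofPred_forall]
    refine MeasurableSet.inter ?_ ?_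
    · refine MeasurableSet.iInter fun i => MeasurableSet.iInter fun j => MeasurableSet.iInter
        fun _ => (measurableSet_eq_fun (hmeas i) (hmeas j)).compl
    · refine MeasurableSet.iInter fun j => MeasurableSet.inter ?_ (hmeas j hB)
      exact (measurable_fst.prodMk (hmeas j)) hG
  apply MeasureTheory.AnalyticSet.measurableSet_of_compl (key B hB k)
  convert key Bᶜ hB.compl (n + 1 - k) using 1
  ext x
  have h1 : ((G.neighborFinset x).filter (· ∈ B)).card +
      ((G.neighborFinset x).filter (· ∈ Bᶜ)).card = n := by
    rw [← hn x, ← G.card_neighborFinset_eq_degree]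
    exact Finset.card_filter_add_card_filter_not _
  simp only [Set.mem_compl_iff, Set.mem_ofPred_eq] at h1 ⊢
  omega

open Classical in
theorem exists_measurable_neighbor_enumeration (G : SimpleGraph V) [G.LocallyFinite]
    (hG : G.IsBorelGraph) {n : ℕ} (hn : G.IsRegularOfDegree n) :
    ∃ f : Fin n → V → V, (∀ i, Measurable (f i)) ∧ (∀ x i j, f i x = f j x → i = j) ∧
      ∀ x y, G.Adj x y ↔ ∃ i, f i x = y := by
  obtain ⟨ι, hι⟩ := MeasureTheory.exists_measurableEmbedding_real V
  have hcard : ∀ x, ((G.neighborFinset x).image ι).card = n := fun x => by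
    rw [Finset.card_image_of_injective _ hι.injective, G.card_neighborFinset_eq_degree, hn x]
  let h : ∀ x, Fin n ↪o ℝ := fun x => ((G.neighborFinset x).image ι).orderEmbOfFin (hcard x)
  have hmem : ∀ x i, ∃ y, G.Adj x y ∧ ι y = h x i := fun x i => by
    obtain ⟨y, hy, hyi⟩ := Finset.mem_image.1
      (Finset.orderEmbOfFin_mem ((G.neighborFinset x).image ι) (hcard x) i)
    exact ⟨y, (G.mem_neighborFinset x y).1 hy, hyi⟩
  choose f hfadj hfh using hmem
  refine ⟨fun i x => f x i, fun i => ?_, fun x i j hij => ?_, fun x y => ⟨fun hxy => ?_, ?_⟩⟩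
  · rw [← hι.measurable_comp_iff]
    refine measurable_of_Iio fun q => ?_
    -- Neighbors are listed in increasing order of `ι` from index 0, so the i-th lies below q iff at
    -- least i + 1 of them do.
    convert measurableSet_le_card_neighborFinset_filter G hG hn
      (hι.measurable (measurableSet_Iio (a := q))) (i + 1) using 1
    ext x
    have hcount : ((G.neighborFinset x).filter (· ∈ ι ⁻¹' Set.Iio q)).card =
        (Finset.univ.filter fun j => h x j < q).card := by
      rw [← Finset.card_image_of_injective _ hι.injective,
        ← Finset.card_image_of_injective _ (h x).injective]
      congr 1
      ext r
      have hr : (∃ y, G.Adj x y ∧ ι y = r) ↔ ∃ j, h x j = r := by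
        have hrange : r ∈ Set.range (h x) ↔ r ∈ (G.neighborFinset x).image ι := by
          rw [Finset.range_orderEmbOfFin, Finset.mem_coe]
        rw [← Set.mem_range, hrange, Finset.mem_image]
        simp only [mem_neighborFinset]
      simp only [Finset.mem_image, Finset.mem_filter, mem_neighborFinset, Finset.mem_univ,
        true_and, Set.mem_preimage, Set.mem_Iio]
      constructor
      · rintro ⟨y, ⟨hy, hq⟩, rfl⟩
        obtain ⟨j, hj⟩ := hr.1 ⟨y, hy, rfl⟩
        exact ⟨j, hj ▸ hq, hj⟩
      · rintro ⟨j, hq, rfl⟩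
        obtain ⟨y, hy, hyj⟩ := hr.2 ⟨j, rfl⟩
        exact ⟨y, ⟨hy, hyj ▸ hq⟩, hyj⟩
    simp only [Set.mem_preimage, Function.comp_apply, Set.mem_Iio, Set.mem_ofPred_eq, hfh]
    have hcount' := hcount
    simp only [Set.mem_preimage, Set.mem_Iio] at hcount'
    rw [hcount']
    constructor
    · intro hi
      rw [← Fin.card_Iic i]
      apply Finset.card_le_card
      intro j hj
      simp only [Finset.mem_filter, Finset.mem_univ, true_and]
      exact lt_of_le_of_lt ((h x).monotone (Finset.mem_Iic.1 hj)) hi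
    · intro hi
      by_contra hq
      have : (Finset.univ.filter fun j => h x j < q).card ≤ (Finset.Iio i).card := by
        apply Finset.card_le_card
        intro j hj
        simp only [Finset.mem_filter, Finset.mem_univ, true_and] at hj
        exact Finset.mem_Iio.2 ((h x).lt_iff_lt.1 (lt_of_lt_of_le hj (not_lt.1 hq)))
      rw [Fin.card_Iio] at this
      omega
  · apply (h x).injective
    rw [← hfh, ← hfh]
    exact congrArg ι hij
  · have hr : ι y ∈ Set.range (h x) := by
      rw [Finset.range_orderEmbOfFin]
      exact Finset.mem_image_of_mem _ ((G.mem_neighborFinset x y).2 hxy)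
    obtain ⟨i, hi⟩ := hr
    exact ⟨i, hι.injective (by rw [hfh, hi])⟩
  · rintro ⟨i, rfl⟩
    exact hfadj x i

end SimpleGraph

/-! ### Baire category genericity for increasing sequences of Borel approximations -/

open Topology in
-- A nonempty open U is not meagre, so some U ∩ Q i is not. By the Baire property Q i equals an open
-- O modulo meagre, and W = U ∩ O works.
theorem exists_isOpen_sdiff_isMeagre_of_iUnion_mem_residual {X : Type*} [TopologicalSpace X]
    [BaireSpace X] [MeasurableSpace X] [BorelSpace X] {Q : ℕ → Set X}
    (hQ : ∀ i, MeasurableSet (Q i)) (hres : (⋃ i, Q i) ∈ residual X) {U : Set X} (hU : IsOpen U)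
    (hne : U.Nonempty) :
    ∃ i, ∃ W ⊆ U, IsOpen W ∧ W.Nonempty ∧ IsMeagre (W \ Q i) := by
  by_contra! hcon
  refine not_isMeagre_of_isOpen hU hne ?_
  have hmeagre : ∀ i, IsMeagre (U ∩ Q i) := by
    intro i
    obtain ⟨O, hO, hQO⟩ := (hQ i).residualEq_isOpen
    have hd1 : IsMeagre (O \ Q i) := by
      change _ ∈ residual X
      filter_upwards [hQO.mem_iff] with x hx hx'
      exact hx'.2 (hx.2 hx'.1)
    have hd2 : IsMeagre (Q i \ O) := by
      change _ ∈ residual X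
      filter_upwards [hQO.mem_iff] with x hx hx'
      exact hx'.2 (hx.1 hx'.1)
    have hempty : U ∩ O = ∅ := by
      by_contra hn
      exact hcon i (U ∩ O) Set.inter_subset_left (hU.inter hO) (Set.nonempty_iff_ne_empty.2 hn)
        (hd1.mono fun x hx => (⟨hx.1.2, hx.2⟩ : x ∈ O \ Q i))
    refine hd2.mono fun x hx => (⟨hx.2, fun hxO => ?_⟩ : x ∈ Q i \ O)
    exact (hempty ▸ (⟨hx.1, hxO⟩ : x ∈ U ∩ O) : x ∈ (∅ : Set X))
  have hcompl : IsMeagre (⋃ i, Q i)ᶜ := by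
    change _ ∈ residual X
    rwa [compl_compl]
  refine ((isMeagre_iUnion hmeagre).union hcompl).mono fun x hx => ?_
  by_cases hxQ : x ∈ ⋃ i, Q i
  · obtain ⟨i, hi⟩ := Set.mem_iUnion.1 hxQ
    exact Or.inl (Set.mem_iUnion.2 ⟨i, hx, hi⟩)
  · exact Or.inr hxQ

open Topology in
-- E equals an open O modulo meagre. Were O to miss a nonempty open U, E would be meagre in U,
-- contradicting its being comeager in some W ⊆ U; so O is dense.
theorem MeasurableSet.mem_residual_of_forall_isOpen {X : Type*} [TopologicalSpace X]
    [BaireSpace X] [MeasurableSpace X] [BorelSpace X] {E : Set X} (hE : MeasurableSet E)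
    (h : ∀ U : Set X, IsOpen U → U.Nonempty →
      ∃ W ⊆ U, IsOpen W ∧ W.Nonempty ∧ IsMeagre (W \ E)) : E ∈ residual X := by
  obtain ⟨O, hO, hEO⟩ := hE.residualEq_isOpen
  have hdense : Dense O := by
    rw [dense_iff_inter_open]
    intro U hU hne
    by_contra hn
    obtain ⟨W, hWU, hW, hWne, hWE⟩ := h U hU hne
    refine not_isMeagre_of_isOpen hW hWne ?_
    have hd : IsMeagre (E \ O) := by
      change _ ∈ residual X
      filter_upwards [hEO.mem_iff] with x hx hx'
      exact hx'.2 (hx.1 hx'.1)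
    refine (hWE.union hd).mono fun x hx => ?_
    by_cases hxE : x ∈ E
    · exact Or.inr ⟨hxE, fun hxO => hn ⟨x, hWU hx, hxO⟩⟩
    · exact Or.inl ⟨hx, hxE⟩
  filter_upwards [residual_of_dense_open hO hdense, hEO.mem_iff] with x hx hx'
  exact hx'.2 hx

/-- There are countably many tasks: an index n and a basic open set B. Stage by stage, each task is
met by an extension whose Q n is comeager in some nonempty open subset of B; localization then makes
each union comeager. -/
theorem exists_monotone_seq_forall_iUnion_mem_residual {X : Type*} [TopologicalSpace X]
    [SecondCountableTopology X] [BaireSpace X] [MeasurableSpace X] [BorelSpace X]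
    {S : Type*} [Preorder S] {ι : Type*} [Countable ι] (Q : ι → S → Set X)
    (hQ : ∀ n s, MeasurableSet (Q n s))
    (hext : ∀ n s, ∃ e : ℕ → S, (∀ i, s ≤ e i) ∧ (⋃ i, Q n (e i)) ∈ residual X) (s₀ : S) :
    ∃ s : ℕ → S, Monotone s ∧ ∀ n, (⋃ k, Q n (s k)) ∈ residual X := by
  classical
  have hstep : ∀ (j : ι × TopologicalSpace.countableBasis X) (s : S),
      ∃ s', s ≤ s' ∧ ∃ W ⊆ j.2.1, IsOpen W ∧ W.Nonempty ∧ IsMeagre (W \ Q j.1 s') := by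
    intro j s
    obtain ⟨e, he, hres⟩ := hext j.1 s
    obtain ⟨i, hi⟩ := exists_isOpen_sdiff_isMeagre_of_iUnion_mem_residual
      (fun i => hQ j.1 (e i)) hres (TopologicalSpace.isOpen_of_mem_countableBasis j.2.2)
      (TopologicalSpace.nonempty_of_mem_countableBasis j.2.2)
    exact ⟨e i, he i, hi⟩
  choose F hF hFW using hstep
  let := Encodable.ofCountable (ι × TopologicalSpace.countableBasis X)
  let s : ℕ → S := fun m => Nat.rec s₀ (fun m t =>
    (Encodable.decode (α := ι × TopologicalSpace.countableBasis X) m).elim t fun j => F j t) m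
  have hs : ∀ m, s (m + 1) =
    (Encodable.decode (α := ι × TopologicalSpace.countableBasis X) m).elim (s m)
      fun j => F j (s m) := fun m => rfl
  refine ⟨s, monotone_nat_of_le_succ fun m => ?_, fun n => ?_⟩
  · rw [hs]
    cases Encodable.decode (α := ι × TopologicalSpace.countableBasis X) m with
    | none => exact le_rfl
    | some j => exact hF j _
  · refine (MeasurableSet.iUnion fun k => hQ n (s k)).mem_residual_of_forall_isOpen ?_
    intro U hU hne
    obtain ⟨x, hx⟩ := hne
    obtain ⟨B, hB, -, hBU⟩ :=
      (TopologicalSpace.isBasis_countableBasis X).exists_subset_of_mem_open hx hU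
    let j : ι × TopologicalSpace.countableBasis X := (n, ⟨B, hB⟩)
    obtain ⟨W, hWB, hW, hWne, hWQ⟩ := hFW j (s (Encodable.encode j))
    refine ⟨W, hWB.trans hBU, hW, hWne, hWQ.mono ?_⟩
    refine Set.sdiff_subset_sdiff_right ?_
    have : s (Encodable.encode j + 1) = F j (s (Encodable.encode j)) := by
      rw [hs, Encodable.encodek]
      rfl
    exact this ▸ Set.subset_iUnion (fun k => Q n (s k)) (Encodable.encode j + 1)

/-! ### Path-closed and connected vertex sets in acyclic graphs -/

namespace SimpleGraph

variable {V : Type*} {G : SimpleGraph V}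

/-- Every path of length at most `n` with endpoints in `T` stays in `T`. -/
def PathClosed (G : SimpleGraph V) (n : ℕ) (T : Set V) : Prop :=
  ∀ ⦃u v : V⦄ (p : G.Walk u v), p.IsPath → p.length ≤ n → u ∈ T → v ∈ T → ∀ w ∈ p.support, w ∈ T

/-- Any two points of `S` are joined by a walk inside `S`. -/
def Linked (G : SimpleGraph V) (S : Set V) : Prop :=
  ∀ u ∈ S, ∀ v ∈ S, ∃ p : G.Walk u v, ∀ w ∈ p.support, w ∈ S

theorem Linked.of_root {S : Set V} (z : V)
    (h : ∀ u ∈ S, ∃ p : G.Walk z u, ∀ w ∈ p.support, w ∈ S) : G.Linked S := by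
  intro u hu v hv
  obtain ⟨p, hp⟩ := h u hu
  obtain ⟨q, hq⟩ := h v hv
  refine ⟨p.reverse.append q, fun w hw => ?_⟩
  rw [Walk.mem_support_append_iff, Walk.support_reverse, List.mem_reverse] at hw
  exact hw.elim (hp w) (hq w)

theorem Linked.pathClosed {S : Set V} (hS : G.Linked S) (hG : G.IsAcyclic) (n : ℕ) :
    G.PathClosed n S := by
  classical
  intro u v p hp _ hu hv w hw
  obtain ⟨q, hq⟩ := hS u hu v hv
  have heq : p = q.bypass :=
    congrArg Subtype.val ((hG.subsingleton_path u v).elim ⟨p, hp⟩ ⟨q.bypass, q.bypass_isPath⟩)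
  exact hq w (q.support_bypass_subset_support (heq ▸ hw))

theorem PathClosed.mem_of_adj₂ {T : Set V} {n : ℕ} (hT : G.PathClosed n T) (hG : G.IsAcyclic)
    (hn : 2 ≤ n) {a b c : V} (hab : G.Adj a b) (hbc : G.Adj b c) (hac : a ≠ c) (ha : a ∈ T)
    (hc : c ∈ T) : b ∈ T := by
  refine hT (Walk.cons hab (Walk.cons hbc Walk.nil)) ?_ (by simpa using hn) ha hc b (by simp)
  rw [hG.isPath_iff_isChain]
  simp [hac, hab.ne]

theorem PathClosed.mem_of_adj₃ {T : Set V} {n : ℕ} (hT : G.PathClosed n T) (hG : G.IsAcyclic)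
    (hn : 3 ≤ n) {a b c d : V} (hab : G.Adj a b) (hbc : G.Adj b c) (hcd : G.Adj c d) (hac : a ≠ c)
    (hbd : b ≠ d) (ha : a ∈ T) (hd : d ∈ T) : b ∈ T := by
  refine hT (Walk.cons hab (Walk.cons hbc (Walk.cons hcd Walk.nil))) ?_ (by simpa using hn)
    ha hd b (by simp)
  rw [hG.isPath_iff_isChain]
  simp [hac, hbd, hab.ne, hbc.ne]

theorem PathClosed.mem_of_adj₄ {T : Set V} {n : ℕ} (hT : G.PathClosed n T) (hG : G.IsAcyclic)
    (hn : 4 ≤ n) {a b c d e : V} (hab : G.Adj a b) (hbc : G.Adj b c) (hcd : G.Adj c d)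
    (hde : G.Adj d e) (hac : a ≠ c) (hbd : b ≠ d) (hce : c ≠ e) (ha : a ∈ T) (he : e ∈ T) :
    c ∈ T := by
  refine hT (Walk.cons hab (Walk.cons hbc (Walk.cons hcd (Walk.cons hde Walk.nil)))) ?_
    (by simpa using hn) ha he c (by simp)
  rw [hG.isPath_iff_isChain]
  simp [hac, hbd, hce, hab.ne, hbc.ne, hcd.ne]

/-! ### Finite connected sets and sparse sets of vertices -/

variable [DecidableEq V]

/-- Finite sets of vertices obtained from a vertex by successively adding neighbors, that is,
nonempty finite connected sets. -/
inductive Grown (G : SimpleGraph V) : Finset V → Prop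
  | single (z : V) : Grown G {z}
  | insert {S : Finset V} {p v : V} : Grown G S → p ∈ S → G.Adj p v → v ∉ S → Grown G (insert v S)

theorem Grown.linked {S : Finset V} (hS : G.Grown S) : G.Linked (S : Set V) := by
  obtain ⟨z, hz⟩ : ∃ z, ∀ u ∈ S, ∃ p : G.Walk z u, ∀ w ∈ p.support, w ∈ S := by
    induction hS with
    | single z =>
      refine ⟨z, fun u hu => ?_⟩
      obtain rfl := Finset.mem_singleton.1 hu
      exact ⟨Walk.nil, by simp⟩
    | @insert S p v _ hp hpv _ ih =>
      obtain ⟨z, hz⟩ := ih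
      refine ⟨z, fun u hu => ?_⟩
      rcases Finset.mem_insert.1 hu with rfl | hu
      · obtain ⟨q, hq⟩ := hz p hp
        refine ⟨q.concat hpv, fun w hw => ?_⟩
        rw [Walk.support_concat, List.mem_append, List.mem_singleton] at hw
        rcases hw with hw | rfl
        · exact Finset.mem_insert_of_mem (hq w hw)
        · exact Finset.mem_insert_self _ _
      · obtain ⟨q, hq⟩ := hz u hu
        exact ⟨q, fun w hw => Finset.mem_insert_of_mem (hq w hw)⟩
  exact Linked.of_root z hz

theorem Grown.exists_superset_of_walk {K : Finset V} (hK : G.Grown K) {u t : V} (p : G.Walk u t)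
    (hu : u ∈ K) : ∃ K', G.Grown K' ∧ K ⊆ K' ∧ t ∈ K' ∧ K'.card ≤ K.card + p.length := by
  induction p generalizing K with
  | nil => exact ⟨K, hK, Finset.Subset.refl _, hu, by simp⟩
  | @cons u v t h p ih =>
    by_cases hv : v ∈ K
    · obtain ⟨K', h1, h2, h3, h4⟩ := ih hK hv
      exact ⟨K', h1, h2, h3, h4.trans (by simp)⟩
    · obtain ⟨K', h1, h2, h3, h4⟩ := ih (hK.insert hu h hv) (Finset.mem_insert_self _ _)
      refine ⟨K', h1, (Finset.subset_insert _ _).trans h2, h3, ?_⟩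
      rw [Finset.card_insert_of_notMem hv] at h4
      rw [Walk.length_cons]
      omega

open Classical in
/-- The set `T` has density less than `1/4` in large finite connected sets. -/
def SparseSet (G : SimpleGraph V) (T : Set V) : Prop :=
  ∃ c ε : ℝ, 0 ≤ ε ∧ ε < 1 / 4 ∧
    ∀ S : Finset V, G.Grown S → ((S.filter (· ∈ T)).card : ℝ) ≤ c + ε * S.card

open Classical in
-- Otherwise a connected set containing z could absorb points of T forever, each at the cost of at
-- most 4 new vertices, and so reach density about 1/4 in T.
theorem SparseSet.exists_grown_isolated {T : Set V} (hT : G.SparseSet T) (z : V) :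
    ∃ K, G.Grown K ∧ z ∈ K ∧ ∀ u ∈ K, ∀ t ∈ T, ∀ p : G.Walk u t, p.length ≤ 4 → t ∈ K := by
  obtain ⟨c, ε, hε0, hε, hc⟩ := hT
  by_contra! hcon
  have hlarge : ∀ m : ℕ, ∃ K, G.Grown K ∧ z ∈ K ∧ K.card ≤ 1 + 4 * (K.filter (· ∈ T)).card ∧
      m ≤ (K.filter (· ∈ T)).card := by
    intro m
    induction m with
    | zero => exact ⟨{z}, Grown.single z, Finset.mem_singleton_self z, by simp, by simp⟩
    | succ m ih =>
      obtain ⟨K, hK, hz, hcard, hm⟩ := ih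
      obtain ⟨u, hu, t, ht, p, hp, htK⟩ := hcon K hK hz
      obtain ⟨K', hK', hsub, htK', hcard'⟩ := hK.exists_superset_of_walk p hu
      have hlt : (K.filter (· ∈ T)).card < (K'.filter (· ∈ T)).card := by
        apply Finset.card_lt_card
        refine ⟨Finset.filter_subset_filter _ hsub, fun hs => htK ?_⟩
        exact (Finset.mem_filter.1 (hs (Finset.mem_filter.2 ⟨htK', ht⟩))).1
      exact ⟨K', hK', hsub hz, by omega, by omega⟩
  -- If N ≥ m points of K lie in T, then N ≤ c + ε(1 + 4N), that is, N(1 - 4ε) ≤ c + ε, which this m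
  -- contradicts.
  obtain ⟨m, hm⟩ := exists_nat_gt ((c + ε) / (1 - 4 * ε))
  obtain ⟨K, hK, -, hcard, hmK⟩ := hlarge m
  have h1 := hc K hK
  have h2 : (K.card : ℝ) ≤ 1 + 4 * (K.filter (· ∈ T)).card := by exact_mod_cast hcard
  have h3 : (m : ℝ) ≤ (K.filter (· ∈ T)).card := by exact_mod_cast hmK
  rw [div_lt_iff₀ (by linarith)] at hm
  have h4 := mul_le_mul_of_nonneg_left h2 hε0
  have h5 := mul_le_mul_of_nonneg_right h3 (show 0 ≤ 1 - 4 * ε by linarith)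
  linarith

open Classical in
-- The q-balls about points of R are disjoint. If R has two points, a path in S from each towards
-- another one puts q + 1 vertices of S in its ball.
theorem Linked.card_le_one_or_card_mul_le {S R : Finset V} (hS : G.Linked (S : Set V))
    (hRS : R ⊆ S) {q : ℕ}
    (hR : ∀ a ∈ R, ∀ b ∈ R, a ≠ b → ∀ p : G.Walk a b, 2 * q < p.length) :
    R.card ≤ 1 ∨ R.card * (q + 1) ≤ S.card := by
  rw [or_iff_not_imp_left]
  intro hcard
  let B : V → Finset V := fun a => S.filter fun x => ∃ p : G.Walk a x, p.length ≤ q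
  have hdisj : (R : Set V).PairwiseDisjoint B := by
    intro a ha b hb hab
    rw [Function.onFun, Finset.disjoint_left]
    intro x hxa hxb
    obtain ⟨-, p, hp⟩ := Finset.mem_filter.1 hxa
    obtain ⟨-, p', hp'⟩ := Finset.mem_filter.1 hxb
    have := hR a ha b hb hab (p.append p'.reverse)
    rw [Walk.length_append, Walk.length_reverse] at this
    omega
  have hB : ∀ a ∈ R, q + 1 ≤ (B a).card := by
    intro a ha
    obtain ⟨b, hb, hba⟩ := Finset.exists_mem_ne (not_le.1 hcard) a
    obtain ⟨p, hp⟩ := hS a (hRS ha) b (hRS hb)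
    have hlen := hR a ha b hb hba.symm p.bypass
    calc q + 1 = ((Finset.range (q + 1)).image p.bypass.getVert).card := by
          rw [Finset.card_image_of_injOn, Finset.card_range]
          intro i hi j hj hij
          rw [Finset.coe_range, Set.mem_Iio] at hi hj
          refine p.bypass_isPath.getVert_injOn ?_ ?_ hij <;> simp only [Set.mem_ofPred_eq] <;> omega
      _ ≤ (B a).card := by
          apply Finset.card_le_card
          intro x hx
          obtain ⟨i, hi, rfl⟩ := Finset.mem_image.1 hx
          rw [Finset.mem_range] at hi
          refine Finset.mem_filter.2 ⟨?_, p.bypass.take i, ?_⟩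
          · exact hp _ (p.support_bypass_subset_support (Walk.getVert_mem_support _ _))
          · rw [Walk.take_length]
            omega
  calc R.card * (q + 1) ≤ ∑ a ∈ R, (B a).card := by
        rw [← smul_eq_mul]
        exact Finset.card_nsmul_le_sum _ _ _ hB
    _ = (R.biUnion B).card := (Finset.card_biUnion hdisj).symm
    _ ≤ S.card := Finset.card_le_card
        (Finset.biUnion_subset.2 fun a _ => Finset.filter_subset _ _)

open Classical in
-- Each centre adds at most m points. Centres whose pieces meet S yield representatives in S more
-- than 2q apart, so there are at most 1 + |S|/(q + 1) of them: the density grows by m/(q + 1), made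
-- smaller than 1/4 - ε by the choice of q.
theorem SparseSet.exists_sparseSet_union {T : Set V} (hT : G.SparseSet T) (m r : ℕ) :
    ∃ n : ℕ, ∀ (A : Set V) (K : V → Finset V) (T' : Set V),
      (∀ a ∈ A, ∀ b ∈ A, a ≠ b → ∀ p : G.Walk a b, n < p.length) →
      (∀ a ∈ A, (K a).card ≤ m) → (∀ a ∈ A, ∀ x ∈ K a, ∃ p : G.Walk a x, p.length ≤ r) →
      (∀ x ∈ T', x ∈ T ∨ ∃ a ∈ A, x ∈ K a) → G.SparseSet T' := by
  obtain ⟨c, ε, hε0, hε, hc⟩ := hT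
  obtain ⟨q, hq⟩ := exists_nat_gt (m / (1 / 4 - ε))
  refine ⟨2 * q + 2 * r, fun A K T' hA hKm hKr hT' => ?_⟩
  refine ⟨c + m, ε + m / (q + 1), by positivity, ?_, fun S hS => ?_⟩
  · rw [div_lt_iff₀ (by linarith)] at hq
    have : (m : ℝ) / (q + 1) < 1 / 4 - ε := by
      rw [div_lt_iff₀ (by positivity)]
      linarith
    linarith
  let N : Finset V := S.filter fun x => ∃ a ∈ A, x ∈ K a
  have hsplit : (S.filter (· ∈ T')).card ≤ (S.filter (· ∈ T)).card + N.card := by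
    refine (Finset.card_le_card fun x hx => ?_).trans (Finset.card_union_le _ _)
    obtain ⟨hxS, hxT'⟩ := Finset.mem_filter.1 hx
    exact Finset.mem_union.2 ((hT' x hxT').imp (fun h => Finset.mem_filter.2 ⟨hxS, h⟩)
      fun h => Finset.mem_filter.2 ⟨hxS, h⟩)
  have hex : ∀ x ∈ N, ∃ a ∈ A, x ∈ K a := fun x hx => (Finset.mem_filter.1 hx).2
  choose! φ hφA hφK using hex
  have hfib : N.card ≤ m * (N.image φ).card := by
    refine Finset.card_le_mul_card_image _ _ fun a ha => ?_
    obtain ⟨x, hx, rfl⟩ := Finset.mem_image.1 ha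
    refine (Finset.card_le_card fun y hy => ?_).trans (hKm _ (hφA x hx))
    obtain ⟨hy, hyx⟩ := Finset.mem_filter.1 hy
    exact hyx ▸ hφK y hy
  have hrep : ∀ a ∈ N.image φ, ∃ x ∈ N, φ x = a := fun a ha => Finset.mem_image.1 ha
  choose! ρ hρN hρφ using hrep
  have hfar : ∀ a ∈ N.image φ, ∀ b ∈ N.image φ, a ≠ b → ∀ p : G.Walk (ρ a) (ρ b),
      2 * q < p.length := by
    intro a ha b hb hab p
    have hKa := hφK _ (hρN a ha)
    have hKb := hφK _ (hρN b hb)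
    have hAa := hφA _ (hρN a ha)
    have hAb := hφA _ (hρN b hb)
    rw [hρφ a ha] at hKa hAa
    rw [hρφ b hb] at hKb hAb
    obtain ⟨pa, hpa⟩ := hKr a hAa _ hKa
    obtain ⟨pb, hpb⟩ := hKr b hAb _ hKb
    have := hA a hAa b hAb hab ((pa.append p).append pb.reverse)
    rw [Walk.length_append, Walk.length_append, Walk.length_reverse] at this
    omega
  have hinj : Set.InjOn ρ (N.image φ : Finset V) := by
    intro a ha b hb hab
    rw [← hρφ a ha, ← hρφ b hb, hab]
  have hcount := hS.linked.card_le_one_or_card_mul_le (R := (N.image φ).image ρ) (q := q)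
    (fun x hx => by
      obtain ⟨a, ha, rfl⟩ := Finset.mem_image.1 hx
      exact (Finset.mem_filter.1 (hρN a ha)).1)
    (fun x hx y hy hxy p => by
      obtain ⟨a, ha, rfl⟩ := Finset.mem_image.1 hx
      obtain ⟨b, hb, rfl⟩ := Finset.mem_image.1 hy
      exact hfar a ha b hb (fun h => hxy (h ▸ rfl)) p)
  rw [Finset.card_image_of_injOn hinj] at hcount
  have hZ : ((N.image φ).card : ℝ) ≤ 1 + S.card / (q + 1) := by
    rcases hcount with h | h
    · have h' : ((N.image φ).card : ℝ) ≤ 1 := by exact_mod_cast h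
      have : (0 : ℝ) ≤ S.card / (q + 1) := by positivity
      linarith
    · have h' : ((N.image φ).card : ℝ) * (q + 1) ≤ S.card := by exact_mod_cast h
      rw [← le_div_iff₀ (by positivity)] at h'
      linarith
  have h1 : ((S.filter (· ∈ T')).card : ℝ) ≤ (S.filter (· ∈ T)).card + N.card := by
    exact_mod_cast hsplit
  have h2 : (N.card : ℝ) ≤ m * (N.image φ).card := by exact_mod_cast hfib
  have h3 := mul_le_mul_of_nonneg_left hZ (Nat.cast_nonneg (α := ℝ) m)
  have h4 := hc S hS
  have h5 : (m : ℝ) * (1 + S.card / (q + 1)) = m + m / (q + 1) * S.card := by ring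
  have h6 : (ε + m / (q + 1)) * (S.card : ℝ) = ε * S.card + m / (q + 1) * S.card := by ring
  linarith

end SimpleGraph

/-! ### Partial labellings by generators of the free group -/

/-- The free generators of the free group of rank two together with their inverses. -/
abbrev SignedGenerator : Type := Fin 2 × Bool

namespace SignedGenerator

/-- The inverse of a signed generator. -/
def inv (s : SignedGenerator) : SignedGenerator := (s.1, !s.2)

@[simp] theorem inv_inv (s : SignedGenerator) : s.inv.inv = s := by simp [inv]

end SignedGenerator

/-- A labelling of the edges at one vertex: the four signed generators are matched with the four
edges. -/
abbrev StarLabelling : Type := SignedGenerator ≃ Fin 4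

theorem StarLabelling.exists_extension (R : SignedGenerator → Fin 4 → Prop)
    (hfun : ∀ s i j, R s i → R s j → i = j) (hinj : ∀ s s' i, R s i → R s' i → s = s') :
    ∃ e : StarLabelling, ∀ s i, R s i → e s = i := by
  classical
  let g : SignedGenerator → Fin 4 := fun s => if h : ∃ i, R s i then h.choose else 0
  have hg : ∀ s i, R s i → g s = i := fun s i h => by
    have h' : ∃ i, R s i := ⟨i, h⟩
    simp only [g, dif_pos h']
    exact hfun s _ _ h'.choose_spec h
  obtain ⟨e, he⟩ := Finset.exists_equiv_extend_of_card_eq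
    (α := SignedGenerator) (t := (Finset.univ : Finset (Fin 4)))
    (s := Finset.univ.filter fun s => ∃ i, R s i) (f := g) (by decide)
    (Finset.subset_univ _) (by
      intro s hs s' hs' h
      obtain ⟨-, i, hi⟩ := Finset.mem_filter.1 hs
      obtain ⟨-, j, hj⟩ := Finset.mem_filter.1 hs'
      rw [hg s i hi, hg s' j hj] at h
      exact hinj s s' i hi (h ▸ hj))
  refine ⟨e.trans (Equiv.subtypeUnivEquiv fun i => Finset.mem_univ i), fun s i h => ?_⟩
  have := he s (Finset.mem_filter.2 ⟨Finset.mem_univ s, i, h⟩)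
  simpa [hg s i h] using this

/-- When a forbidden pair (s₀, i₀) exists, R uses at most one edge, so if s₀ is still free it can be
sent to a third edge. -/
theorem StarLabelling.exists_extension_avoiding (R B : SignedGenerator → Fin 4 → Prop)
    (hfun : ∀ s i j, R s i → R s j → i = j) (hinj : ∀ s s' i, R s i → R s' i → s = s')
    (hB : ∀ s i s' i', B s i → B s' i' → s = s' ∧ i = i')
    (hBR : ∀ s i s' i', B s i → R s' i' → i ≠ i')
    (hBR' : ∀ s i s₁ i₁ s₂ i₂, B s i → R s₁ i₁ → R s₂ i₂ → i₁ = i₂) :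
    ∃ e : StarLabelling, (∀ s i, R s i → e s = i) ∧ ∀ s i, B s i → e s ≠ i := by
  by_cases hex : ∃ s i, B s i
  swap
  · obtain ⟨e, he⟩ := StarLabelling.exists_extension R hfun hinj
    exact ⟨e, he, fun s i h => (hex ⟨s, i, h⟩).elim⟩
  obtain ⟨s₀, i₀, h₀⟩ := hex
  by_cases hR : ∃ i, R s₀ i
  · obtain ⟨i, hi⟩ := hR
    obtain ⟨e, he⟩ := StarLabelling.exists_extension R hfun hinj
    refine ⟨e, he, fun s j hj => ?_⟩
    obtain ⟨rfl, rfl⟩ := hB _ _ _ _ h₀ hj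
    rw [he _ _ hi]
    exact (hBR _ _ _ _ h₀ hi).symm
  obtain ⟨i₁, hi₁, hRi₁⟩ : ∃ i₁, i₁ ≠ i₀ ∧ ∀ s, ¬R s i₁ := by
    by_cases hne : ∃ s i, R s i
    · obtain ⟨s, i, hi⟩ := hne
      have hthird : ∀ a b : Fin 4, ∃ c, c ≠ a ∧ c ≠ b := by decide
      obtain ⟨c, hc, hci⟩ := hthird i₀ i
      exact ⟨c, hc, fun s' hs' => hci (hBR' _ _ _ _ _ _ h₀ hs' hi)⟩
    · have hsecond : ∀ a : Fin 4, ∃ c, c ≠ a := by decide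
      obtain ⟨c, hc⟩ := hsecond i₀
      exact ⟨c, hc, fun s hs => hne ⟨s, c, hs⟩⟩
  obtain ⟨e, he⟩ := StarLabelling.exists_extension (fun s i => R s i ∨ (s = s₀ ∧ i = i₁)) (by
      rintro s i j (hi | ⟨rfl, rfl⟩) (hj | ⟨hs, rfl⟩)
      · exact hfun s i j hi hj
      · exact (hR ⟨i, hs ▸ hi⟩).elim
      · exact (hR ⟨j, hj⟩).elim
      · rfl) (by
      rintro s s' i (hi | ⟨rfl, rfl⟩) (hj | ⟨hs, hi'⟩)
      · exact hinj s s' i hi hj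
      · exact (hRi₁ s (hi' ▸ hi)).elim
      · exact (hRi₁ s' hj).elim
      · exact hs.symm)
  refine ⟨e, fun s i h => he s i (Or.inl h), fun s i h => ?_⟩
  obtain ⟨rfl, rfl⟩ := hB _ _ _ _ h₀ h
  rw [he _ i₁ (Or.inr ⟨rfl, rfl⟩)]
  exact hi₁

/-! ### Extending a compatible labelling over a finite connected set -/

namespace SimpleGraph

variable {V : Type*} {G : SimpleGraph V} {f : Fin 4 → V → V}

/-- `f` enumerates the neighbors of every vertex of `G` without repetitions. -/
structure IsNeighborEnumeration (G : SimpleGraph V) (f : Fin 4 → V → V) : Prop where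
  injective : ∀ x i j, f i x = f j x → i = j
  adj_iff : ∀ x y, G.Adj x y ↔ ∃ i, f i x = y

theorem IsNeighborEnumeration.adj (hf : G.IsNeighborEnumeration f) (i : Fin 4) (x : V) :
    G.Adj x (f i x) := (hf.adj_iff x _).2 ⟨i, rfl⟩

/-- Labels of an edge between two labelled vertices are inverse to each other. -/
def EdgeCompatible (f : Fin 4 → V → V) (t : V → Option StarLabelling) : Prop :=
  ∀ x y d e s, t x = some d → t y = some e → f (d s) x = y → f (e s.inv) y = x

/-- At an unlabelled vertex, the edges from labelled vertices have distinct labels. -/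
def SeparatedAtGaps (f : Fin 4 → V → V) (t : V → Option StarLabelling) : Prop :=
  ∀ v x y d e s, t v = none → t x = some d → t y = some e → f (d s) x = v → f (e s) y = v → x = y

theorem PathClosed.separatedAtGaps (hG : G.IsAcyclic) (hf : G.IsNeighborEnumeration f)
    {t : V → Option StarLabelling} (ht : G.PathClosed 4 {x | t x ≠ none}) :
    SeparatedAtGaps f t := by
  intro v x y d e s hv hx hy hxv hyv
  by_contra hne
  refine ht.mem_of_adj₂ hG (by norm_num) (hxv ▸ hf.adj (d s) x) (hyv ▸ (hf.adj (e s) y).symm)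
    hne ?_ ?_ hv <;> simp [*]

/-- T is the original domain and S the connected set labelled since. Path-closedness of both limits
the constraints at v to the configurations handled by `StarLabelling.exists_extension_avoiding`. -/
theorem exists_update_labelling [DecidableEq V] (hG : G.IsAcyclic)
    (hf : G.IsNeighborEnumeration f) {T S : Set V} {t : V → Option StarLabelling}
    (hT : G.PathClosed 4 T) (hS : ∀ n, G.PathClosed n S) (ht : ∀ x, t x ≠ none ↔ x ∈ T ∨ x ∈ S)
    (hcomp : EdgeCompatible f t) (hgap : SeparatedAtGaps f t) {v : V} (hv : t v = none)
    (hSv : S = ∅ ∨ ∃ p ∈ S, G.Adj p v) :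
    ∃ e, EdgeCompatible f (Function.update t v (some e)) ∧
      SeparatedAtGaps f (Function.update t v (some e)) := by
  have hvT : v ∉ T := fun h => (ht v).2 (Or.inl h) hv
  have hvS : v ∉ S := fun h => (ht v).2 (Or.inr h) hv
  -- `R` collects the labels forced by labelled neighbors; `B` collects those that would repeat, at
  -- an unlabelled neighbor, a letter already arriving there.
  let R : SignedGenerator → Fin 4 → Prop := fun σ i =>
    ∃ d, t (f i v) = some d ∧ f (d σ.inv) (f i v) = v
  let B : SignedGenerator → Fin 4 → Prop := fun σ i =>
    t (f i v) = none ∧ ∃ y d, y ≠ v ∧ t y = some d ∧ f (d σ) y = f i v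
  -- A blocking vertex in S would be joined to p ∈ S by a path of length 3 through v, forcing v into
  -- S.
  have hBT : ∀ σ i y d, t (f i v) = none → y ≠ v → t y = some d → f (d σ) y = f i v → y ∈ T := by
    intro σ i y d hi hyv hy hyi
    refine ((ht y).1 (by simp [hy])).resolve_right fun hyS => hvS ?_
    obtain rfl | ⟨p, hp, hpv⟩ := hSv
    · exact hyS.elim
    · have hpi : p ≠ f i v := fun h => (ht p).2 (Or.inr hp) (h ▸ hi)
      exact (hS 3).mem_of_adj₃ hG le_rfl hpv (hf.adj i v) (hyi ▸ (hf.adj (d σ) y).symm) hpi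
        hyv.symm hp hyS
  have hBadj : ∀ {σ : SignedGenerator} {i y} {d : StarLabelling}, f (d σ) y = f i v →
      G.Adj y (f i v) := fun {σ i y d} h => h ▸ hf.adj (d σ) y
  obtain ⟨e, heR, heB⟩ := StarLabelling.exists_extension_avoiding R B
    (by
      rintro σ i j ⟨d, hd, hdv⟩ ⟨d', hd', hdv'⟩
      exact hf.injective v i j (hgap v _ _ d d' σ.inv hv hd hd' hdv hdv'))
    (by
      rintro σ σ' i ⟨d, hd, hdv⟩ ⟨d', hd', hdv'⟩
      obtain rfl : d = d' := Option.some.inj (hd.symm.trans hd')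
      have := d.injective (hf.injective _ _ _ (hdv.trans hdv'.symm))
      rw [← SignedGenerator.inv_inv σ, this, SignedGenerator.inv_inv])
    (by
      rintro σ i σ' i' ⟨hi, y, d, hyv, hy, hyi⟩ ⟨hi', y', d', hyv', hy', hyi'⟩
      have hyT := hBT _ _ _ _ hi hyv hy hyi
      have hyT' := hBT _ _ _ _ hi' hyv' hy' hyi'
      have hii : i = i' := by
        by_contra hne
        -- Two blocked edges would give a path of length 4 with ends in T and midpoint v: the origin
        -- of the constant 4.
        exact hvT (hT.mem_of_adj₄ hG le_rfl (hBadj hyi) (hf.adj i v).symm (hf.adj i' v)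
          (hBadj hyi').symm hyv (fun h => hne (hf.injective _ _ _ h)) hyv'.symm hyT hyT')
      subst hii
      have hyy : y = y' := by
        by_contra hne
        exact (ht _).2 (Or.inl (hT.mem_of_adj₂ hG (by norm_num) (hBadj hyi) (hBadj hyi').symm
          hne hyT hyT')) hi
      subst hyy
      obtain rfl : d = d' := Option.some.inj (hy.symm.trans hy')
      exact ⟨d.injective (hf.injective _ _ _ (hyi.trans hyi'.symm)), rfl⟩)
    (by
      rintro σ i σ' i' ⟨hi, -⟩ ⟨d, hd, -⟩ rfl
      rw [hi] at hd
      cases hd)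
    (by
      rintro σ i σ₁ i₁ σ₂ i₂ ⟨hi, y, d, hyv, hy, hyi⟩ ⟨d₁, hd₁, -⟩ ⟨d₂, hd₂, -⟩
      have hyT := hBT _ _ _ _ hi hyv hy hyi
      -- With a blocked edge present, a labelled neighbor of v in T would close a path of length 3
      -- through the unlabelled `f i v`. So the labelled neighbors lie in S, and two of them would
      -- put v in S.
      have hmem : ∀ j d, t (f j v) = some d → f j v ∈ S := by
        intro j d' hj
        refine ((ht _).1 (by simp [hj])).resolve_left fun hjT => hvT ?_
        have hne : f j v ≠ f i v := fun h => by
          rw [h, hi] at hj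
          cases hj
        exact ((ht _).2 (Or.inl (hT.mem_of_adj₃ hG (by norm_num) (hBadj hyi) (hf.adj i v).symm
          (hf.adj j v) hyv hne.symm hyT hjT)) hi).elim
      by_contra hne
      exact hvS ((hS 2).mem_of_adj₂ hG le_rfl (hf.adj i₁ v).symm (hf.adj i₂ v)
        (fun h => hne (hf.injective _ _ _ h)) (hmem _ _ hd₁) (hmem _ _ hd₂)))
  have hself : ∀ i, f i v ≠ v := fun i h => G.loopless.irrefl v (by simpa [h] using hf.adj i v)
  refine ⟨e, ?_, ?_⟩
  · intro x y d d' s hx hy hxy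
    rcases eq_or_ne x v with rfl | hxv
    · rw [Function.update_self, Option.some_inj] at hx
      subst hx
      have hyx : y ≠ x := fun h => hself _ (hxy.trans h)
      rw [Function.update_of_ne hyx] at hy
      obtain ⟨j, hj⟩ := (hf.adj_iff y x).1 (hxy ▸ (hf.adj (e s) x).symm)
      have := heR (d'.symm j).inv (e s) ⟨d', hxy ▸ hy, by simpa [hxy] using hj⟩
      have := e.injective this
      rw [← this]
      simpa using hj
    · rw [Function.update_of_ne hxv] at hx
      rcases eq_or_ne y v with rfl | hyv
      · rw [Function.update_self, Option.some_inj] at hy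
        subst hy
        obtain ⟨i, rfl⟩ := (hf.adj_iff y x).1 (hxy ▸ (hf.adj (d s) x).symm)
        rw [heR s.inv i ⟨d, hx, by simpa using hxy⟩]
      · rw [Function.update_of_ne hyv] at hy
        exact hcomp x y d d' s hx hy hxy
  · intro u x y d d' s hu hx hy hxu hyu
    have huv : u ≠ v := by
      rintro rfl
      simp at hu
    rw [Function.update_of_ne huv] at hu
    have hmixed : ∀ y d', y ≠ v → t y = some d' → f (e s) v = u → f (d' s) y = u → False := by
      rintro y d' hyv hy rfl hyu
      exact heB s (e s) ⟨hu, y, d', hyv, hy, hyu⟩ rfl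
    by_cases hxv : x = v <;> by_cases hyv : y = v
    · rw [hxv, hyv]
    · subst hxv
      rw [Function.update_self, Option.some_inj] at hx
      subst hx
      rw [Function.update_of_ne hyv] at hy
      exact (hmixed y d' hyv hy hxu hyu).elim
    · subst hyv
      rw [Function.update_self, Option.some_inj] at hy
      subst hy
      rw [Function.update_of_ne hxv] at hx
      exact (hmixed x d hxv hx hyu hxu).elim
    · rw [Function.update_of_ne hxv] at hx
      rw [Function.update_of_ne hyv] at hy
      exact hgap u x y d d' s hu hx hy hxu hyu

/-- Vertices are added in the order in which S grows. `SeparatedAtGaps` is the extra induction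
hypothesis that keeps unlabelled vertices from receiving conflicting demands; initially it follows
from path-closedness. -/
theorem Grown.exists_labelling_extension [DecidableEq V] (hG : G.IsAcyclic)
    (hf : G.IsNeighborEnumeration f) {t : V → Option StarLabelling}
    (hT : G.PathClosed 4 {x | t x ≠ none}) (hcomp : EdgeCompatible f t) {S : Finset V}
    (hS : G.Grown S) :
    ∃ t' : V → Option StarLabelling, (∀ x d, t x = some d → t' x = some d) ∧
      (∀ x, t' x ≠ none ↔ t x ≠ none ∨ x ∈ S) ∧ EdgeCompatible f t' ∧ SeparatedAtGaps f t' := by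
  have step : ∀ (S : Finset V) (t' : V → Option StarLabelling) (v : V),
      (∀ n, G.PathClosed n (S : Set V)) → ((S : Set V) = ∅ ∨ ∃ p ∈ (S : Set V), G.Adj p v) →
      (∀ x d, t x = some d → t' x = some d) → (∀ x, t' x ≠ none ↔ t x ≠ none ∨ x ∈ S) →
      EdgeCompatible f t' → SeparatedAtGaps f t' →
      ∃ t'' : V → Option StarLabelling, (∀ x d, t x = some d → t'' x = some d) ∧
        (∀ x, t'' x ≠ none ↔ t x ≠ none ∨ x ∈ Insert.insert v S) ∧ EdgeCompatible f t'' ∧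
        SeparatedAtGaps f t'' := by
    intro S t' v hS hSv hext hdom hcomp' hgap
    by_cases hv : t' v = none
    · obtain ⟨e, he, he'⟩ := exists_update_labelling hG hf hT hS hdom hcomp' hgap hv hSv
      refine ⟨_, fun x d hx => ?_, fun x => ?_, he, he'⟩
      · rw [Function.update_of_ne, hext x d hx]
        rintro rfl
        rw [hext _ _ hx] at hv
        cases hv
      · rcases eq_or_ne x v with rfl | hxv
        · simp
        · rw [Function.update_of_ne hxv, hdom, Finset.mem_insert, or_iff_right hxv]
    · refine ⟨t', hext, fun x => ?_, hcomp', hgap⟩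
      rw [hdom, Finset.mem_insert]
      constructor
      · exact Or.imp_right Or.inr
      · rintro (h | rfl | h)
        · exact Or.inl h
        · exact (hdom x).1 hv
        · exact Or.inr h
  induction hS with
  | single z =>
    refine step ∅ t z (fun n => ?_) (Or.inl (by simp)) (fun x d h => h) (by simp) hcomp
      (hT.separatedAtGaps hG hf)
    rw [Finset.coe_empty]
    exact fun _ _ _ _ _ h => h.elim
  | @insert S p v hS hp hpv _ ih =>
    obtain ⟨t', h1, h2, h3, h4⟩ := ih
    exact step S t' v (fun n => hS.linked.pathClosed hG n) (Or.inr ⟨p, hp, hpv⟩) h1 h2 h3 h4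

end SimpleGraph

/-! ### Borel partial labellings and their local extensions -/

namespace SimpleGraph

variable {V : Type*} {G : SimpleGraph V} {f : Fin 4 → V → V}

theorem IsNeighborEnumeration.exists_walk (hf : G.IsNeighborEnumeration f) (w : List (Fin 4))
    (x : V) : ∃ p : G.Walk x (w.foldr f x), p.length = w.length := by
  induction w with
  | nil => exact ⟨Walk.nil, rfl⟩
  | cons i w ih =>
    obtain ⟨p, hp⟩ := ih
    exact ⟨p.concat (hf.adj i _), (Walk.length_concat _ _).trans (congrArg (· + 1) hp)⟩

theorem IsNeighborEnumeration.exists_word (hf : G.IsNeighborEnumeration f) {x y : V}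
    (p : G.Walk x y) : ∃ w : List (Fin 4), w.length = p.length ∧ w.foldr f x = y ∧
      ∀ u, u <:+ w → u.foldr f x ∈ p.support := by
  induction p with
  | nil => exact ⟨[], rfl, rfl, fun u hu => by simp [List.suffix_nil.1 hu]⟩
  | @cons x v y h p ih =>
    obtain ⟨w, hw, hwy, hsuf⟩ := ih
    obtain ⟨i, hi⟩ := (hf.adj_iff x v).1 h
    refine ⟨w ++ [i], by simp [hw], by simp [hi, hwy], fun u hu => ?_⟩
    rcases List.suffix_concat_iff.1 hu with rfl | ⟨u', rfl, hu'⟩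
    · simp
    · rw [List.foldr_append, List.foldr_cons, List.foldr_nil, hi, Walk.support_cons]
      exact List.mem_cons_of_mem _ (hsuf u' hu')

theorem IsNeighborEnumeration.measurable_foldr [MeasurableSpace V]
    (hf : ∀ i, Measurable (f i)) (w : List (Fin 4)) : Measurable fun x => w.foldr f x := by
  induction w with
  | nil => exact measurable_id
  | cons i w ih => exact (hf i).comp ih

/-- A finite labelled pattern, whose vertices are addressed by words in the neighbor functions. -/
abbrev LabelPattern : Type := Finset (List (Fin 4) × StarLabelling)

/-- The vertices occupied by a pattern placed at `z`. -/
def LabelPattern.carrier [DecidableEq V] (f : Fin 4 → V → V) (P : LabelPattern) (z : V) :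
    Finset V :=
  P.image fun a => a.1.foldr f z

/-- The pattern `P` may be placed at `z` in order to extend the partial labelling `t`. -/
structure LabelPattern.IsValidAt (f : Fin 4 → V → V) (t : V → Option StarLabelling)
    (P : LabelPattern) (z : V) : Prop where
  nil_mem : ∃ d, ([], d) ∈ P
  suffix_mem : ∀ i w d, (i :: w, d) ∈ P → ∃ d', (w, d') ∈ P
  consistent : ∀ a ∈ P, ∀ b ∈ P, a.1.foldr f z = b.1.foldr f z → a.2 = b.2
  extend : ∀ a ∈ P, ∀ d, t (a.1.foldr f z) = some d → d = a.2
  compatible : ∀ a ∈ P, ∀ b ∈ P, ∀ s, f (a.2 s) (a.1.foldr f z) = b.1.foldr f z →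
    f (b.2 s.inv) (b.1.foldr f z) = a.1.foldr f z
  isolated : ∀ a ∈ P, ∀ u : List (Fin 4), u.length ≤ 4 → ∀ d,
    t (u.foldr f (a.1.foldr f z)) = some d →
      ∃ b, b ∈ P ∧ u.foldr f (a.1.foldr f z) = b.1.foldr f z

theorem LabelPattern.measurableSet_isValidAt [MeasurableSpace V] [StandardBorelSpace V]
    (hf : ∀ i, Measurable (f i)) {t : V → Option StarLabelling}
    (ht : ∀ d, MeasurableSet {x | t x = some d}) (P : LabelPattern) :
    MeasurableSet {z | P.IsValidAt f t z} := by
  have hw := IsNeighborEnumeration.measurable_foldr hf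
  have hset : {z | P.IsValidAt f t z} = {z |
      (∃ d, ([], d) ∈ P) ∧ (∀ i w d, (i :: w, d) ∈ P → ∃ d', (w, d') ∈ P) ∧
      (∀ a, a ∈ P → ∀ b, b ∈ P → a.1.foldr f z = b.1.foldr f z → a.2 = b.2) ∧
      (∀ a, a ∈ P → ∀ d, t (a.1.foldr f z) = some d → d = a.2) ∧
      (∀ a, a ∈ P → ∀ b, b ∈ P → ∀ s, f (a.2 s) (a.1.foldr f z) = b.1.foldr f z →
        f (b.2 s.inv) (b.1.foldr f z) = a.1.foldr f z) ∧
      (∀ a, a ∈ P → ∀ u : List (Fin 4), u.length ≤ 4 → ∀ d,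
        t (u.foldr f (a.1.foldr f z)) = some d →
          ∃ b, b ∈ P ∧ u.foldr f (a.1.foldr f z) = b.1.foldr f z)} := by
    ext z
    exact ⟨fun h => ⟨h.1, h.2, h.3, h.4, h.5, h.6⟩,
      fun ⟨h1, h2, h3, h4, h5, h6⟩ => ⟨h1, h2, h3, h4, h5, h6⟩⟩
  have heq : ∀ {g h : V → V}, Measurable g → Measurable h → Measurable fun z => g z = h z :=
    fun hg hh => measurableSet_setOfPred.1 (measurableSet_eq_fun hg hh)
  have htm : ∀ {g : V → V} (d), Measurable g → Measurable fun z => t (g z) = some d :=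
    fun d hg => measurableSet_setOfPred.1 (hg (ht d))
  rw [hset, measurableSet_setOfPred]
  refine measurable_const.and (measurable_const.and (Measurable.and ?_ (Measurable.and ?_
    (Measurable.and ?_ ?_))))
  · exact Measurable.forall fun a => measurable_const.imp <| Measurable.forall fun b =>
      measurable_const.imp <| (heq (hw _) (hw _)).imp measurable_const
  · exact Measurable.forall fun a => measurable_const.imp <| Measurable.forall fun d =>
      (htm d (hw _)).imp measurable_const
  · exact Measurable.forall fun a => measurable_const.imp <| Measurable.forall fun b =>
      measurable_const.imp <| Measurable.forall fun s =>
        (heq ((hf _).comp (hw _)) (hw _)).imp (heq ((hf _).comp (hw _)) (hw _))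
  · exact Measurable.forall fun a => measurable_const.imp <| Measurable.forall fun u =>
      measurable_const.imp <| Measurable.forall fun d =>
        (htm d ((hw u).comp (hw _))).imp <| Measurable.exists fun b =>
          measurable_const.and (heq ((hw u).comp (hw _)) (hw _))

theorem LabelPattern.IsValidAt.linked_carrier [DecidableEq V] (hf : G.IsNeighborEnumeration f)
    {t : V → Option StarLabelling} {P : LabelPattern} {z : V} (h : P.IsValidAt f t z) :
    G.Linked (P.carrier f z : Set V) := by
  refine Linked.of_root z fun u hu => ?_
  obtain ⟨⟨w, d⟩, hw, rfl⟩ := Finset.mem_image.1 (Finset.mem_coe.1 hu)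
  induction w generalizing d with
  | nil => exact ⟨Walk.nil, by simpa using hu⟩
  | cons i w ih =>
    obtain ⟨d', hd'⟩ := h.suffix_mem i w d hw
    obtain ⟨p, hp⟩ := ih d' hd' (Finset.mem_coe.2 (Finset.mem_image_of_mem (fun a => a.1.foldr f z) hd'))
    refine ⟨p.concat (hf.adj i _), fun x hx => ?_⟩
    have hx' := (Walk.support_concat p (hf.adj i _)) ▸ hx
    rcases List.mem_append.1 hx' with hx | hx
    · exact hp x hx
    · rw [List.mem_singleton.1 hx]
      exact hu

/-- A Borel labelling of a sparse set of vertices, all of whose finite pieces are far apart. -/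
structure PartialLabelling [DecidableEq V] [MeasurableSpace V] (G : SimpleGraph V)
    (f : Fin 4 → V → V) where
  label : V → Option StarLabelling
  measurableSet_label : ∀ d, MeasurableSet {x | label x = some d}
  edgeCompatible : EdgeCompatible f label
  pathClosed : G.PathClosed 4 {x | label x ≠ none}
  sparse : G.SparseSet {x | label x ≠ none}

variable [DecidableEq V]

instance [MeasurableSpace V] : Preorder (PartialLabelling G f) where
  le t t' := ∀ x d, t.label x = some d → t'.label x = some d
  le_refl _ _ _ h := h
  le_trans _ _ _ h h' x d hx := h' x d (h x d hx)

theorem exists_isValidAt (hG : G.IsAcyclic) (hf : G.IsNeighborEnumeration f)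
    {t : V → Option StarLabelling} (hcomp : EdgeCompatible f t)
    (hclosed : G.PathClosed 4 {x | t x ≠ none}) (hsparse : G.SparseSet {x | t x ≠ none}) (z : V) :
    ∃ P : LabelPattern, P.IsValidAt f t z := by
  obtain ⟨K, hK, hz, hiso⟩ := hsparse.exists_grown_isolated z
  obtain ⟨t', hext, hdom, hcomp', -⟩ := hK.exists_labelling_extension hG hf hclosed hcomp
  have hword : ∀ x ∈ K, ∃ w : List (Fin 4), w.foldr f z = x ∧ ∀ u, u <:+ w → u.foldr f z ∈ K := by
    intro x hx
    obtain ⟨p, hp⟩ := hK.linked z hz x hx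
    obtain ⟨w, -, hw, hsuf⟩ := hf.exists_word p
    exact ⟨w, hw, fun u hu => hp _ (hsuf u hu)⟩
  choose! w hw hsuf using hword
  have hlabel : ∀ x ∈ K, ∃ d, t' x = some d := fun x hx =>
    Option.ne_none_iff_exists'.1 ((hdom x).2 (Or.inr hx))
  have hne : Nonempty StarLabelling := ⟨(hlabel z hz).choose⟩
  choose! τ hτ using hlabel
  let P : LabelPattern :=
    (K.biUnion fun x => (w x).tails.toFinset).image fun u => (u, τ (u.foldr f z))
  have hP : ∀ a, a ∈ P ↔ (∃ x ∈ K, a.1 <:+ w x) ∧ a.2 = τ (a.1.foldr f z) := by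
    rintro ⟨u, d⟩
    simp only [P, Finset.mem_image, Finset.mem_biUnion, List.mem_toFinset, List.mem_tails,
      Prod.mk.injEq]
    constructor
    · rintro ⟨u', h, rfl, rfl⟩
      exact ⟨h, rfl⟩
    · rintro ⟨h, rfl⟩
      exact ⟨u, h, rfl, rfl⟩
  have hPK : ∀ a ∈ P, a.1.foldr f z ∈ K := by
    intro a ha
    obtain ⟨⟨x, hx, hu⟩, -⟩ := (hP a).1 ha
    exact hsuf x hx _ hu
  have hPlabel : ∀ a ∈ P, t' (a.1.foldr f z) = some a.2 := by
    intro a ha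
    rw [hτ _ (hPK a ha), ((hP a).1 ha).2]
  refine ⟨P, ?_, ?_, ?_, ?_, ?_, ?_⟩
  · exact ⟨τ z, (hP _).2 ⟨⟨z, hz, List.nil_suffix⟩, rfl⟩⟩
  · intro i u d hu
    obtain ⟨⟨x, hx, hux⟩, -⟩ := (hP _).1 hu
    exact ⟨τ (u.foldr f z), (hP (u, _)).2 ⟨⟨x, hx, (List.suffix_cons i u).trans hux⟩, rfl⟩⟩
  · intro a ha b hb hab
    exact Option.some.inj ((hPlabel a ha).symm.trans (hab ▸ hPlabel b hb))
  · intro a ha d hd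
    exact Option.some.inj ((hext _ _ hd).symm.trans (hPlabel a ha))
  · intro a ha b hb s hs
    exact hcomp' _ _ _ _ s (hPlabel a ha) (hPlabel b hb) hs
  · intro a ha u hu d hd
    obtain ⟨p, hp⟩ := hf.exists_walk u (a.1.foldr f z)
    have hmem := hiso _ (hPK a ha) _ (show t _ ≠ none by simp [hd]) p (hp ▸ hu)
    exact ⟨(w _, τ ((w _).foldr f z)), (hP _).2 ⟨⟨_, hmem, List.suffix_rfl⟩, rfl⟩,
      (hw _ hmem).symm⟩

/-- Copies of P at distant centres do not interact, and isolation separates each copy from old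
labels outside it. Hence labelled vertices within distance 4 of a copy lie in it, and each invariant
is checked inside one copy or in the old labelling. -/
theorem PartialLabelling.exists_extension_of_discrete [MeasurableSpace V] [StandardBorelSpace V]
    (hG : G.IsAcyclic) (hf : G.IsNeighborEnumeration f) (hfm : ∀ i, Measurable (f i))
    (t : PartialLabelling G f) (P : LabelPattern) :
    ∃ n : ℕ, ∀ A : Set V, MeasurableSet A → (∀ z ∈ A, P.IsValidAt f t.label z) →
      (∀ a ∈ A, ∀ b ∈ A, a ≠ b → ∀ p : G.Walk a b, n < p.length) →
      ∃ t' : PartialLabelling G f, t ≤ t' ∧ ∀ z ∈ A, t'.label z ≠ none := by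
  classical
  let r := P.sup fun a => a.1.length
  obtain ⟨n, hn⟩ := t.sparse.exists_sparseSet_union P.card r
  -- The first bound preserves sparsity; the second keeps copies of radius r more than 4 apart.
  refine ⟨max n (r + 4 + r), fun A hA hvalid hdisc => ?_⟩
  let K : V → Finset V := P.carrier f
  have hKmem : ∀ z x, x ∈ K z ↔ ∃ a ∈ P, a.1.foldr f z = x := fun z x => Finset.mem_image
  have hKwalk : ∀ z x, x ∈ K z → ∃ p : G.Walk z x, p.length ≤ r := by
    intro z x hx
    obtain ⟨a, ha, rfl⟩ := (hKmem z x).1 hx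
    obtain ⟨p, hp⟩ := hf.exists_walk a.1 z
    exact ⟨p, hp ▸ Finset.le_sup (f := fun a : List (Fin 4) × StarLabelling => a.1.length) ha⟩
  have huniq : ∀ a ∈ A, ∀ b ∈ A, ∀ x ∈ K a, ∀ y ∈ K b, ∀ p : G.Walk x y, p.length ≤ 4 → a = b := by
    intro a ha b hb x hx y hy p hp
    by_contra hab
    obtain ⟨pa, hpa⟩ := hKwalk a x hx
    obtain ⟨pb, hpb⟩ := hKwalk b y hy
    have := hdisc a ha b hb hab ((pa.append p).append pb.reverse)
    rw [Walk.length_append, Walk.length_append, Walk.length_reverse] at this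
    omega
  let τ : V → Option StarLabelling := fun x =>
    if h : ∃ d, ∃ z ∈ A, ∃ a ∈ P, a.1.foldr f z = x ∧ a.2 = d then some h.choose else t.label x
  have hτK : ∀ z ∈ A, ∀ a ∈ P, τ (a.1.foldr f z) = some a.2 := by
    intro z hz a ha
    have h : ∃ d, ∃ z' ∈ A, ∃ a' ∈ P, a'.1.foldr f z' = a.1.foldr f z ∧ a'.2 = d :=
      ⟨a.2, z, hz, a, ha, rfl, rfl⟩
    simp only [τ, dif_pos h]
    obtain ⟨z', hz', a', ha', heq, hd⟩ := h.choose_spec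
    obtain rfl : z = z' := huniq z hz z' hz' _ ((hKmem _ _).2 ⟨a, ha, rfl⟩) _
      ((hKmem _ _).2 ⟨a', ha', heq⟩) Walk.nil (by simp)
    rw [← hd, (hvalid z hz).consistent a' ha' a ha heq]
  have hτt : ∀ x, (∀ z ∈ A, x ∉ K z) → τ x = t.label x := by
    intro x hx
    refine dif_neg ?_
    rintro ⟨d, z, hz, a, ha, hax, -⟩
    exact hx z hz ((hKmem _ _).2 ⟨a, ha, hax⟩)
  have hle : ∀ x d, t.label x = some d → τ x = some d := by
    intro x d hd
    by_cases hx : ∃ z ∈ A, x ∈ K z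
    · obtain ⟨z, hz, hx⟩ := hx
      obtain ⟨a, ha, rfl⟩ := (hKmem _ _).1 hx
      rw [hτK z hz a ha, (hvalid z hz).extend a ha d hd]
    · push Not at hx
      rw [hτt x hx, hd]
  have hdomK : ∀ z ∈ A, ∀ x ∈ K z, τ x ≠ none := by
    intro z hz x hx
    obtain ⟨a, ha, rfl⟩ := (hKmem _ _).1 hx
    simp [hτK z hz a ha]
  have hdom : ∀ x, τ x ≠ none → t.label x ≠ none ∨ ∃ z ∈ A, x ∈ K z := by
    intro x hx
    rw [or_iff_not_imp_right]
    intro h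
    push Not at h
    rwa [← hτt x h]
  have hnear : ∀ z ∈ A, ∀ x ∈ K z, ∀ y, τ y ≠ none → ∀ p : G.Walk x y, p.length ≤ 4 → y ∈ K z := by
    intro z hz x hx y hy p hp
    rcases hdom y hy with hty | ⟨z', hz', hyz'⟩
    · obtain ⟨a, ha, rfl⟩ := (hKmem _ _).1 hx
      obtain ⟨u, hu, rfl, -⟩ := hf.exists_word p
      obtain ⟨d, hd⟩ := Option.ne_none_iff_exists'.1 hty
      obtain ⟨b, hb, hub⟩ := (hvalid z hz).isolated a ha u (hu ▸ hp) d hd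
      exact (hKmem _ _).2 ⟨b, hb, hub.symm⟩
    · rwa [huniq z hz z' hz' x hx y hyz' p hp]
  have hcompK : ∀ z ∈ A, ∀ x ∈ K z, ∀ y ∈ K z, ∀ d e s, τ x = some d → τ y = some e →
      f (d s) x = y → f (e s.inv) y = x := by
    intro z hz x hx y hy d e s hd he hxy
    obtain ⟨a, ha, rfl⟩ := (hKmem _ _).1 hx
    obtain ⟨b, hb, rfl⟩ := (hKmem _ _).1 hy
    rw [hτK z hz _ ha, Option.some_inj] at hd
    rw [hτK z hz _ hb, Option.some_inj] at he
    subst hd he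
    exact (hvalid z hz).compatible a ha b hb s hxy
  refine ⟨⟨τ, fun d => ?_, ?_, ?_, ?_⟩, hle, fun z hz => ?_⟩
  -- A word u leading from x back to its centre replaces the existential over centres by a countable
  -- union of Borel conditions.
  · have hset : {x | τ x = some d} = {x | t.label x = some d} ∪
        ⋃ a ∈ P.filter fun a => a.2 = d, ⋃ u : List (Fin 4),
          {x | u.foldr f x ∈ A ∧ a.1.foldr f (u.foldr f x) = x} := by
      ext x
      simp only [Set.mem_union, Set.mem_iUnion, Finset.mem_filter, Set.mem_ofPred_eq]
      constructor
      · intro hx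
        by_cases h : ∃ z ∈ A, x ∈ K z
        · obtain ⟨z, hz, hxz⟩ := h
          obtain ⟨a, ha, rfl⟩ := (hKmem _ _).1 hxz
          rw [hτK z hz a ha, Option.some_inj] at hx
          obtain ⟨p, -⟩ := hf.exists_walk a.1 z
          obtain ⟨u, -, hu, -⟩ := hf.exists_word p.reverse
          exact Or.inr ⟨a, ⟨ha, hx⟩, u, by rwa [hu], by rw [hu]⟩
        · push Not at h
          exact Or.inl (hτt x h ▸ hx)
      · rintro (hx | ⟨a, ⟨ha, rfl⟩, u, hu, hx⟩)
        · exact hle x d hx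
        · rw [← hτK _ hu a ha, hx]
    rw [hset]
    have hw := IsNeighborEnumeration.measurable_foldr hfm
    refine (t.measurableSet_label d).union (Finset.measurableSet_biUnion _ fun a _ =>
      MeasurableSet.iUnion fun u => (hw u hA).inter ?_)
    exact measurableSet_eq_fun ((hw a.1).comp (hw u)) measurable_id
  · intro x y d e s hx hy hxy
    have hadj : G.Adj x y := hxy ▸ hf.adj _ _
    by_cases h : ∃ z ∈ A, x ∈ K z ∨ y ∈ K z
    · obtain ⟨z, hz, hxz | hyz⟩ := h
      · have hyz := hnear z hz x hxz y (by simp [hy]) hadj.toWalk (by simp)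
        exact hcompK z hz x hxz y hyz d e s hx hy hxy
      · have hxz := hnear z hz y hyz x (by simp [hx]) hadj.symm.toWalk (by simp)
        exact hcompK z hz x hxz y hyz d e s hx hy hxy
    · push Not at h
      rw [hτt x fun z hz => (h z hz).1] at hx
      rw [hτt y fun z hz => (h z hz).2] at hy
      exact t.edgeCompatible x y d e s hx hy hxy
  · intro u v p hp hlen hu hv w hw
    by_cases h : ∃ z ∈ A, u ∈ K z ∨ v ∈ K z
    · obtain ⟨z, hz, huv⟩ := h
      have huz : u ∈ K z := huv.elim id fun hvz =>
        hnear z hz v hvz u hu p.reverse (by rwa [Walk.length_reverse])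
      have hvz := hnear z hz u huz v hv p hlen
      exact hdomK z hz w
        (((hvalid z hz).linked_carrier hf).pathClosed hG 4 p hp hlen huz hvz w hw)
    · push Not at h
      have hu' : t.label u ≠ none := hτt u (fun z hz => (h z hz).1) ▸ hu
      have hv' : t.label v ≠ none := hτt v (fun z hz => (h z hz).2) ▸ hv
      obtain ⟨d, hd⟩ := Option.ne_none_iff_exists'.1 (t.pathClosed p hp hlen hu' hv' w hw)
      exact (by simp [hle w d hd] : τ w ≠ none)
  · exact hn A K _ (fun a ha b hb hab p => lt_of_le_of_lt (le_max_left _ _) (hdisc a ha b hb hab p))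
      (fun a _ => Finset.card_image_le) (fun a _ x hx => hKwalk a x hx) hdom
  · obtain ⟨d, hd⟩ := (hvalid z hz).nil_mem
    have := hτK z hz _ hd
    exact (by simpa using congrArg Option.isSome this : (τ z).isSome) |> Option.isSome_iff_ne_none.1

theorem exists_countable_separating_finite (V : Type*) [MeasurableSpace V]
    [StandardBorelSpace V] : ∃ 𝓑 : Set (Set V), 𝓑.Countable ∧ (∀ B ∈ 𝓑, MeasurableSet B) ∧
      ∀ (z : V) (F : Set V), F.Finite → z ∉ F → ∃ B ∈ 𝓑, z ∈ B ∧ Disjoint B F := by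
  let := upgradeStandardBorel V
  refine ⟨TopologicalSpace.countableBasis V, TopologicalSpace.countable_countableBasis V,
    fun B hB => (TopologicalSpace.isOpen_of_mem_countableBasis hB).measurableSet,
    fun z F hF hz => ?_⟩
  obtain ⟨B, hB, hzB, hBF⟩ := (TopologicalSpace.isBasis_countableBasis V).exists_subset_of_mem_open
    (show z ∈ Fᶜ from hz) hF.isClosed.isOpen_compl
  exact ⟨B, hB, hzB, Set.disjoint_left.2 fun x hx hxF => hBF hx hxF⟩

theorem PartialLabelling.exists_countable_extensions [MeasurableSpace V] [StandardBorelSpace V]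
    (hG : G.IsAcyclic) (hf : G.IsNeighborEnumeration f) (hfm : ∀ i, Measurable (f i))
    (t : PartialLabelling G f) :
    ∃ e : ℕ → PartialLabelling G f, (∀ i, t ≤ e i) ∧ ∀ z, ∃ i, (e i).label z ≠ none := by
  obtain ⟨𝓑, h𝓑, h𝓑m, h𝓑sep⟩ := exists_countable_separating_finite V
  choose n hn using t.exists_extension_of_discrete hG hf hfm
  -- Requiring z to be the only point of B in its `n P`-ball makes `A P B` discrete. Each ball is
  -- finite, so some B in the countable separating family isolates z.
  let A : LabelPattern → Set V → Set V := fun P B => {z | P.IsValidAt f t.label z} ∩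
    (B ∩ {z | ∀ u : List (Fin 4), u.length ≤ n P → u.foldr f z ≠ z → u.foldr f z ∉ B})
  have hw := IsNeighborEnumeration.measurable_foldr hfm
  have hA : ∀ P, ∀ B ∈ 𝓑, MeasurableSet (A P B) := by
    intro P B hB
    refine (P.measurableSet_isValidAt hfm t.measurableSet_label).inter ((h𝓑m B hB).inter ?_)
    rw [measurableSet_setOfPred]
    exact Measurable.forall fun u => measurable_const.imp <|
      (measurableSet_setOfPred.1 (measurableSet_eq_fun (hw u) measurable_id)).not.imp
        (measurableSet_setOfPred.1 (hw u (h𝓑m B hB))).not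
  have hdisc : ∀ P B, ∀ a ∈ A P B, ∀ b ∈ A P B, a ≠ b → ∀ p : G.Walk a b, n P < p.length := by
    intro P B a ha b hb hab p
    by_contra hp
    obtain ⟨u, hu, hub, -⟩ := hf.exists_word p
    exact ha.2.2 u (by omega) (by rw [hub]; exact hab.symm) (hub ▸ hb.2.1)
  have hext : ∀ j : LabelPattern × 𝓑, ∃ t' : PartialLabelling G f, t ≤ t' ∧
      ∀ z ∈ A j.1 j.2, t'.label z ≠ none := fun j =>
    hn j.1 _ (hA j.1 j.2 j.2.2) (fun z hz => hz.1) (hdisc j.1 j.2)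
  choose E hE hEdom using hext
  have : Countable 𝓑 := h𝓑.to_subtype
  let := Encodable.ofCountable (LabelPattern × 𝓑)
  refine ⟨fun i => (Encodable.decode (α := LabelPattern × 𝓑) i).elim t E, fun i => ?_, fun z => ?_⟩
  · dsimp only
    cases Encodable.decode (α := LabelPattern × 𝓑) i with
    | none => exact le_rfl
    | some j => exact hE j
  · obtain ⟨P, hP⟩ := exists_isValidAt hG hf t.edgeCompatible t.pathClosed t.sparse z
    let F : Set V := {y | y ≠ z ∧ ∃ u : List (Fin 4), u.length ≤ n P ∧ u.foldr f z = y}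
    have hF : F.Finite := by
      refine ((List.finite_length_le (Fin 4) (n P)).image fun u => u.foldr f z).subset ?_
      rintro y ⟨-, u, hu, rfl⟩
      exact ⟨u, hu, rfl⟩
    obtain ⟨B, hB, hzB, hBF⟩ := h𝓑sep z F hF fun h => h.1 rfl
    refine ⟨Encodable.encode ((P, ⟨B, hB⟩) : LabelPattern × 𝓑), ?_⟩
    simp only [Encodable.encodek, Option.elim_some]
    exact hEdom (P, ⟨B, hB⟩) z ⟨hP, hzB, fun u hu hne huB =>
      Set.disjoint_left.1 hBF huB ⟨hne, u, hu, rfl⟩⟩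

end SimpleGraph

/-! ### The free group action given by a compatible labelling -/

namespace SimpleGraph

variable {V : Type*} {G : SimpleGraph V} {f : Fin 4 → V → V}

/-- Compatibility makes the steps along s and s⁻¹ mutually inverse. For freeness, a step that hits
the path already traced must go back to its penultimate vertex, which cancels the last letter;
reduced words exclude this. -/
theorem exists_freeGroup_action [MeasurableSpace V] (hG : G.IsAcyclic)
    (hf : G.IsNeighborEnumeration f) (hfm : ∀ i, Measurable (f i)) {A : Set V}
    (hA : ∀ x ∈ A, ∀ i, f i x ∈ A) (l : A → StarLabelling)
    (hl : ∀ d, MeasurableSet {x | l x = d})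
    (hcomp : ∀ (x y : A) s, f (l x s) x = y → f (l y s.inv) y = x) :
    ∃ _ : MulAction (FreeGroup (Fin 2)) A, IsBorelAction (FreeGroup (Fin 2)) A ∧
      IsFreeAction (FreeGroup (Fin 2)) A ∧ ActionGenerates (Fin 2) (G.induce A) := by
  let step : SignedGenerator → A → A := fun s x => ⟨f (l x s) x, hA x x.2 _⟩
  have hstep : ∀ s x, step s.inv (step s x) = x := fun s x => Subtype.ext (hcomp x _ s rfl)
  have hstep_inj : ∀ s s' x, step s x = step s' x → s = s' := fun s s' x h =>
    (l x).injective (hf.injective _ _ _ (congrArg Subtype.val h))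
  have hstep_adj : ∀ s (x : A), G.Adj (x : V) (step s x : V) := fun s x => hf.adj _ _
  have hstep_meas : ∀ s, Measurable (step s) := by
    intro s
    refine Measurable.subtype_mk fun B hB => ?_
    have hset : (fun x : A => f (l x s) x) ⁻¹' B =
        ⋃ d : StarLabelling, {x | l x = d} ∩ {x : A | f (d s) x ∈ B} := by
      ext x
      simp
    rw [hset]
    exact MeasurableSet.iUnion fun d => (hl d).inter (((hfm _).comp measurable_subtype_coe) hB)
  let π : Fin 2 → Equiv.Perm A := fun i =>
    ⟨step (i, true), step (i, false), hstep (i, true), hstep (i, false)⟩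
  let φ : FreeGroup (Fin 2) →* Equiv.Perm A := FreeGroup.lift π
  have hφ : ∀ (L : List (Fin 2 × Bool)) (x : A), φ (FreeGroup.mk L) x = L.foldr step x := by
    intro L x
    induction L with
    | nil => rfl
    | cons a L ih =>
      have hmk : FreeGroup.mk (a :: L) = FreeGroup.mk [a] * FreeGroup.mk L := by
        rw [FreeGroup.mul_mk]
        rfl
      rw [hmk, map_mul, Equiv.Perm.mul_apply, ih, List.foldr_cons]
      obtain ⟨i, b⟩ := a
      cases b <;> simp [φ, π, FreeGroup.lift_mk, ← Equiv.Perm.inv_def] <;> rfl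
  have hpath : ∀ (a : Fin 2 × Bool) (L : List (Fin 2 × Bool)), FreeGroup.IsReduced (a :: L) →
      ∀ x : A, ∃ p : G.Walk (x : V) ((a :: L).foldr step x : A), p.IsPath ∧ 0 < p.length ∧
        p.penultimate = (L.foldr step x : A) := by
    intro a L
    induction L generalizing a with
    | nil =>
      intro _ x
      refine ⟨(hstep_adj a x).toWalk, ?_, ?_, ?_⟩
      · simp [(hstep_adj a x).ne]
      · simp
      · simp
    | cons b L ih =>
      intro hred x
      have hred' : (a.1 = b.1 → a.2 = b.2) ∧ FreeGroup.IsReduced (b :: L) :=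
        List.isChain_cons_cons.1 hred
      obtain ⟨p, hp, -, hpen⟩ := ih b hred'.2 x
      refine ⟨p.concat (hstep_adj a _), ?_, ?_, ?_⟩
      · refine hp.concat (fun hmem => ?_) _
        have hback := hG.eq_penultimate_of_adj_end hp (hstep_adj a _) hmem
        rw [hpen] at hback
        have hab : a = SignedGenerator.inv b := by
          refine hstep_inj _ _ ((b :: L).foldr step x) ?_
          rw [Subtype.ext hback, List.foldr_cons, hstep]
        have := hred'.1 (by rw [hab]; rfl)
        rw [hab] at this
        simp [SignedGenerator.inv] at this
      · exact (Walk.length_concat p (hstep_adj a _)).symm ▸ Nat.succ_pos _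
      · exact Walk.penultimate_concat _ _
  refine ⟨MulAction.compHom A φ, ?_, ?_, ?_⟩
  · intro γ
    change Measurable fun y => φ γ y
    rw [← FreeGroup.mk_toWord (x := γ)]
    simp only [hφ]
    induction γ.toWord with
    | nil => exact measurable_id
    | cons a L ih => exact (hstep_meas a).comp ih
  · intro γ x hx
    change φ γ x = x at hx
    rw [← FreeGroup.toWord_eq_nil_iff]
    rw [← FreeGroup.mk_toWord (x := γ), hφ] at hx
    have hred := FreeGroup.isReduced_toWord (x := γ)
    cases hL : γ.toWord with
    | nil => rfl
    | cons a L =>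
      rw [hL] at hx hred
      obtain ⟨p, hp, hpos, -⟩ := hpath a L hred x
      have hcopy : (p.copy rfl (congrArg Subtype.val hx)).IsPath := by
        rwa [Walk.isPath_copy]
      have hlen := Walk.length_eq_zero_iff.2 (Walk.isPath_iff_nil.1 hcopy)
      rw [Walk.length_copy] at hlen
      omega
  · intro x y
    change G.Adj x y ↔ x ≠ y ∧ ∃ i, φ (FreeGroup.of i) x = y ∨ φ (FreeGroup.of i)⁻¹ x = y
    have hof : ∀ i, φ (FreeGroup.of i) x = step (i, true) x := fun i => hφ [(i, true)] x
    have hof_inv : ∀ i, φ (FreeGroup.of i)⁻¹ x = step (i, false) x := fun i => hφ [(i, false)] x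
    simp only [hof, hof_inv]
    constructor
    · intro hxy
      refine ⟨fun h => hxy.ne (congrArg Subtype.val h), ?_⟩
      obtain ⟨j, hj⟩ := (hf.adj_iff x y).1 hxy
      have hs : step ((l x).symm j) x = y := Subtype.ext (by simp [step, hj])
      rcases hlj : (l x).symm j with ⟨i, b⟩
      rw [hlj] at hs
      cases b
      · exact ⟨i, Or.inr hs⟩
      · exact ⟨i, Or.inl hs⟩
    · rintro ⟨-, i, rfl | rfl⟩ <;> exact hstep_adj _ x

end SimpleGraph

/-! ### Assembly of the generic labelling -/

theorem lemma5p2 {X : Type*} [TopologicalSpace X] [PolishSpace X] [MeasurableSpace X]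
    [BorelSpace X] (C : Set X) (hC : MeasurableSet C) (hCcomeager : C ∈ residual X)
    (G : SimpleGraph C) [G.LocallyFinite] (hBorel : G.IsBorelGraph)
    (hacyclic : G.IsAcyclic) (hreg : G.IsRegularOfDegree 4) :
    ∃ A : Set C,
      MeasurableSet (Subtype.val '' A : Set X) ∧ (Subtype.val '' A : Set X) ∈ residual X ∧
      G.IsInvariantSet A ∧
      ∃ _ : MulAction (FreeGroup (Fin 2)) A,
        IsBorelAction (FreeGroup (Fin 2)) A ∧
        IsFreeAction (FreeGroup (Fin 2)) A ∧
        ActionGenerates (Fin 2) (G.induce A) := by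
  classical
  have := hC.standardBorel
  obtain ⟨f, hfm, hfinj, hfadj⟩ := G.exists_measurable_neighbor_enumeration hBorel hreg
  have hf : G.IsNeighborEnumeration f := ⟨hfinj, hfadj⟩
  have hw := SimpleGraph.IsNeighborEnumeration.measurable_foldr hfm
  -- The neighbor maps need not preserve meagre sets, so labelling comeagerly many x is not enough
  -- to label whole components; one requirement is imposed for each word.
  let Q : List (Fin 4) → G.PartialLabelling f → Set X := fun w t =>
    Subtype.val '' {x : C | t.label (w.foldr f x) ≠ none}
  have hlabelled : ∀ t : G.PartialLabelling f, MeasurableSet {x | t.label x ≠ none} := by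
    intro t
    have hset : {x | t.label x ≠ none} = ⋃ d, {x | t.label x = some d} := by
      ext x
      simp [Option.ne_none_iff_exists']
    rw [hset]
    exact MeasurableSet.iUnion t.measurableSet_label
  let t₀ : G.PartialLabelling f :=
    { label := fun _ => none
      measurableSet_label := fun d => by simp
      edgeCompatible := fun x y d e s h => by cases h
      pathClosed := fun u v p _ _ hu => (hu rfl).elim
      sparse := ⟨0, 0, le_rfl, by norm_num, fun S _ => by simp⟩ }
  obtain ⟨t, htmono, htres⟩ := exists_monotone_seq_forall_iUnion_mem_residual Q
    (fun w t => hC.subtype_image (hw w (hlabelled t))) (fun w t => by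
      obtain ⟨e, he, hdom⟩ := t.exists_countable_extensions hacyclic hf hfm
      refine ⟨e, he, Filter.mem_of_superset hCcomeager fun x hx => ?_⟩
      obtain ⟨i, hi⟩ := hdom (w.foldr f ⟨x, hx⟩)
      exact Set.mem_iUnion.2 ⟨i, ⟨x, hx⟩, hi, rfl⟩) t₀
  let A : Set C := {x | ∀ w : List (Fin 4), ∃ k, (t k).label (w.foldr f x) ≠ none}
  have hAword : ∀ x ∈ A, ∀ u : List (Fin 4), u.foldr f x ∈ A := by
    intro x hx u w
    rw [← List.foldr_append]
    exact hx (w ++ u)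
  have hAreach : ∀ x ∈ A, ∀ y, G.Reachable x y → y ∈ A := by
    rintro x hx y ⟨p⟩
    obtain ⟨u, -, rfl, -⟩ := hf.exists_word p
    exact hAword x hx u
  have hAmeas : MeasurableSet A := by
    have hset : A = ⋂ w : List (Fin 4), ⋃ k, {x | (t k).label (w.foldr f x) ≠ none} := by
      ext x
      simp [A]
    rw [hset]
    exact MeasurableSet.iInter fun w => MeasurableSet.iUnion fun k => hw w (hlabelled (t k))
  have hlabel : ∀ x : A, ∃ d, ∃ k, (t k).label x = some d := by
    intro x
    obtain ⟨k, hk⟩ := x.2 []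
    obtain ⟨d, hd⟩ := Option.ne_none_iff_exists'.1 hk
    exact ⟨d, k, hd⟩
  choose l hl using hlabel
  -- Monotonicity makes the limit label independent of the stage, so compatibility of two labels can
  -- be read off at a common later stage.
  have hlt : ∀ (x : A) d k, (t k).label x = some d → l x = d := by
    intro x d k hd
    obtain ⟨k', hk'⟩ := hl x
    have h1 := htmono (le_max_left k k') x d hd
    have h2 := htmono (le_max_right k k') x (l x) hk'
    exact Option.some.inj (h2.symm.trans h1)
  refine ⟨A, hC.subtype_image hAmeas, ?_, ?_, SimpleGraph.exists_freeGroup_action hacyclic hf hfm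
    (fun x hx i => hAword x hx [i]) l (fun d => ?_) fun x y s hxy => ?_⟩
  · refine Filter.mem_of_superset (Filter.inter_mem hCcomeager (countable_iInter_mem.2 htres)) ?_
    rintro x ⟨hx, hxQ⟩
    refine ⟨⟨x, hx⟩, fun w => ?_, rfl⟩
    obtain ⟨k, y, hy, rfl⟩ := Set.mem_iUnion.1 (Set.mem_iInter.1 hxQ w)
    exact ⟨k, hy⟩
  · refine ⟨{c | ∃ x ∈ A, G.connectedComponentMk x = c}, ?_⟩
    ext y
    simp only [Set.mem_iUnion, SimpleGraph.ConnectedComponent.mem_supp_iff]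
    constructor
    · exact fun hy => ⟨_, ⟨y, hy, rfl⟩, rfl⟩
    · rintro ⟨c, ⟨x, hx, rfl⟩, hyx⟩
      exact hAreach x hx y (SimpleGraph.ConnectedComponent.exact hyx).symm
  · have hset : {x | l x = d} = Subtype.val ⁻¹' ⋃ k, {x | (t k).label x = some d} := by
      ext x
      simp only [Set.mem_preimage, Set.mem_iUnion, Set.mem_ofPred_eq]
      constructor
      · rintro rfl
        exact hl x
      · rintro ⟨k, hk⟩
        exact hlt x d k hk
    rw [hset]
    exact measurable_subtype_coe (MeasurableSet.iUnion fun k => (t k).measurableSet_label d)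
  · obtain ⟨k, hk⟩ := hl x
    obtain ⟨k', hk'⟩ := hl y
    exact (t (max k k')).edgeCompatible x y _ _ s (htmono (le_max_left k k') _ _ hk)
      (htmono (le_max_right k k') _ _ hk') hxy
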